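/- **Theorem (affine Blaschke–Petkantschin formula).** Let $1\le q\le k\le n$ be integers and let $F\in L^1((\mathbb R^n)^{q+1})$ be a real- or complex-valued function, integrable with respect to Lebesgue measure $d\tilde x=dx_0\cdots dx_q$, where $\tilde x=(x_0,\dots,x_q)$. (The space of $n\times(q+1)$ real matrices is identified with $(\mathbb R^n)^{q+1}$ through the columns.) Let $\mathcal A_{n,k}$ be the set of all affine $k$-planes in $\mathbb R^n$ with its standard measure $d\tau=d\xi\,dz$: every $\tau\in\mathcal A_{n,k}$ is uniquely $\tau=\xi+z$ with $\xi$ a $k$-dimensional linear subspace and $z\in\xi^\perp$; here $d\xi$ is the $O(n)$-invariant probability measure on the Grassmannian of $k$-dimensional linear subspaces and $dz$ is Lebesgue measure on $\xi^\perp$. For $\tau\in\mathcal A_{n,k}$ let $d_\tau\tilde x=d_\tau x_0\cdots d_\tau x_q$, where $d_\tau x$ is $k$-dimensional Lebesgue measure on $\tau$. Let $\Delta_q(\tilde x)$ be the $q$-dimensional volume of the convex hull of $\{x_0,\dots,x_q\}$. For $1\le q\le m$ let $$\sigma_{m,q}=\frac{2^q\,\pi^{mq/2}}{\Gamma_q(m/2)},\qquad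 \Gamma_q(\alpha)=\pi^{q(q-1)/4}\prod_{j=0}^{q-1}\Gamma\!\left(\alpha-\tfrac j2\right),$$ the total mass of the Stiefel manifold of orthonormal $q$-frames in $\mathbb R^m$. Then for almost every $\tau\in\mathcal A_{n,k}$ the function $F\,\Delta_q^{\,n-k}$ is integrable on $\tau^{q+1}$, the function $\tau\mapsto\int_{\tau^{q+1}}F(\tilde x)\,\Delta_q(\tilde x)^{n-k}\,d_\tau\tilde x$ is integrable on $\mathcal A_{n,k}$, and $$\int_{(\mathbb R^n)^{q+1}}F(\tilde x)\,d\tilde x\;=\;c\int_{\mathcal A_{n,k}}d\tau\int_{\tau^{q+1}}F(\tilde x)\,\Delta_q(\tilde x)^{n-k}\,d_\tau\tilde x,\qquad c=\frac{(q!)^{\,n-k}\,\sigma_{n,q}}{\sigma_{k,q}}.$$ -/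

import Mathlib

open MeasureTheory

noncomputable section

namespace BlaschkePetkantschin

/-- Euclidean `n`-space. -/
abbrev E (n : ℕ) : Type := EuclideanSpace ℝ (Fin n)

/-! ### The affine Grassmannian -/

/-- The set `A_{n,k}` of all affine `k`-planes in `ℝⁿ`. -/
def AffGr (n k : ℕ) : Type :=
  {τ : AffineSubspace ℝ (E n) // (τ : Set (E n)).Nonempty ∧ Module.finrank ℝ τ.direction = k}

/-- The point of the plane `τ` closest to the origin: the orthogonal projection of `0` to `τ`. -/
def AffGr.foot {n k : ℕ} (τ : AffGr n k) : E n :=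
  haveI : Nonempty τ.1 := τ.2.1.to_subtype
  (EuclideanGeometry.orthogonalProjection τ.1 (0 : E n) : E n)

/-- A plane, encoded by the orthogonal projection onto its direction and by its foot point. -/
def AffGr.code {n k : ℕ} (τ : AffGr n k) : (E n →L[ℝ] E n) × E n :=
  (τ.1.direction.starProjection, τ.foot)

/-- The usual topology of `A_{n,k}`: planes are close when the orthogonal projections onto their
directions are close and their foot points are close. -/
instance (n k : ℕ) : TopologicalSpace (AffGr n k) :=
  TopologicalSpace.induced AffGr.code inferInstance

instance (n k : ℕ) : MeasurableSpace (AffGr n k) := borel _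

instance (n k : ℕ) : BorelSpace (AffGr n k) := ⟨rfl⟩

/-! ### The orthogonal group and its Haar probability measure -/

/-- The orthogonal group `O(n)`: the linear operators `g` on `ℝⁿ` with `gᵀ g = g gᵀ = 1`
(over `ℝ` the adjoint is the transpose). -/
abbrev OrthGroup (n : ℕ) : Type := unitary (E n →L[ℝ] E n)

instance (n : ℕ) : ContinuousStar (E n →L[ℝ] E n) where
  continuous_star := (ContinuousLinearMap.adjoint (𝕜 := ℝ) (E := E n) (F := E n)).continuous

instance (n : ℕ) : CompactSpace (OrthGroup n) := by
  refine isCompact_iff_compactSpace.1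
    (?_ : IsCompact ((unitary (E n →L[ℝ] E n) : Submonoid (E n →L[ℝ] E n)) :
      Set (E n →L[ℝ] E n)))
  refine Metric.isCompact_of_isClosed_isBounded isClosed_unitary ?_
  refine (Metric.isBounded_closedBall (x := (0 : E n →L[ℝ] E n)) (r := 1)).subset ?_
  intro g hg
  rw [mem_closedBall_zero_iff]
  refine ContinuousLinearMap.opNorm_le_bound _ zero_le_one fun x => ?_
  rw [one_mul]
  exact le_of_eq ((Unitary.linearIsometryEquiv ⟨g, hg⟩).norm_map x)

/-- The Haar measure on `O(n)` with total mass `1`. -/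
def orthHaar (n : ℕ) : Measure (OrthGroup n) := Measure.haarMeasure ⊤

/-! ### The standard measure on the affine Grassmannian -/

/-- The coordinate `k`-plane, spanned by the first `k` vectors of the standard basis of `ℝⁿ`. -/
def basePlane (n k : ℕ) : Submodule ℝ (E n) :=
  Submodule.span ℝ ((fun i : Fin n => EuclideanSpace.single i (1 : ℝ)) '' {i | (i : ℕ) < k})

lemma finrank_basePlane {n k : ℕ} (hkn : k ≤ n) : Module.finrank ℝ (basePlane n k) = k := by
  have h1 : (fun i : Fin n => EuclideanSpace.single i (1 : ℝ)) '' {i | (i : ℕ) < k} =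
      Set.range (fun j : Fin k => EuclideanSpace.single (Fin.castLE hkn j) (1 : ℝ)) := by
    ext x
    simp only [Set.mem_image, Set.mem_ofPred_eq, Set.mem_range]
    constructor
    · rintro ⟨i, hi, rfl⟩
      exact ⟨⟨i, hi⟩, rfl⟩
    · rintro ⟨j, rfl⟩
      exact ⟨Fin.castLE hkn j, j.2, rfl⟩
  have h2 : LinearIndependent ℝ
      (fun j : Fin k => EuclideanSpace.single (Fin.castLE hkn j) (1 : ℝ)) := by
    have := (EuclideanSpace.basisFun (Fin n) ℝ).toBasis.linearIndependent.comp _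
      (Fin.castLE_injective hkn)
    simpa [Function.comp_def] using this
  rw [basePlane, h1, finrank_span_eq_card h2, Fintype.card_fin]

/-- The affine `k`-plane `g (ξ₀ + z)`, where `ξ₀` is the coordinate `k`-plane, `z ∈ ξ₀ᗮ` and
`g ∈ O(n)`: it passes through `g z` and has direction `g ξ₀`. -/
def movedPlane {n k : ℕ} (hkn : k ≤ n) (p : OrthGroup n × (basePlane n k)ᗮ) : AffGr n k :=
  ⟨AffineSubspace.mk' ((p.1 : E n →L[ℝ] E n) (p.2 : E n))
      ((basePlane n k).map (Unitary.linearIsometryEquiv p.1).toLinearEquiv.toLinearMap),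
    AffineSubspace.mk'_nonempty _ _, by
      rw [AffineSubspace.direction_mk', LinearEquiv.finrank_map_eq, finrank_basePlane hkn]⟩

/-- The standard measure `dτ` on `A_{n,k}`, that is `dτ = dξ dz` for `τ = ξ + z` with `ξ` a linear
`k`-plane, distributed according to the `O(n)`-invariant probability measure, and `z ∈ ξᗮ`,
distributed according to Lebesgue measure on `ξᗮ`. Here `ξ = g ξ₀` with `g` distributed according
to the Haar probability measure of `O(n)`, and `g` carries Lebesgue measure on `ξ₀ᗮ` to Lebesgue
measure on `ξᗮ`. -/
def affGrMeasure {n k : ℕ} (hkn : k ≤ n) : Measure (AffGr n k) :=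
  ((orthHaar n).prod (volume : Measure (basePlane n k)ᗮ)).map (movedPlane hkn)

lemma movedPlane_code {n k : ℕ} (hkn : k ≤ n) (p : OrthGroup n × (basePlane n k)ᗮ) :
    (movedPlane hkn p).code =
      ((p.1 : E n →L[ℝ] E n) * (basePlane n k).starProjection * star (p.1 : E n →L[ℝ] E n),
        (p.1 : E n →L[ℝ] E n) (p.2 : E n)) := by
  obtain ⟨g, z⟩ := p
  have hdir : (movedPlane hkn (g, z)).1.direction =
      (basePlane n k).map (Unitary.linearIsometryEquiv g).toLinearEquiv.toLinearMap :=
    AffineSubspace.direction_mk' _ _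
  have hproj : (movedPlane hkn (g, z)).1.direction.starProjection =
      (g : E n →L[ℝ] E n) * (basePlane n k).starProjection * star (g : E n →L[ℝ] E n) := by
    ext1 x
    simp only [hdir]
    rw [Submodule.starProjection_map_apply]
    rfl
  refine Prod.ext hproj ?_
  change (movedPlane hkn (g, z)).foot = (g : E n →L[ℝ] E n) (z : E n)
  have : Nonempty (movedPlane hkn (g, z)).1 := (movedPlane hkn (g, z)).2.1.to_subtype
  have hmem : (g : E n →L[ℝ] E n) (z : E n) ∈ (movedPlane hkn (g, z)).1 :=
    AffineSubspace.self_mem_mk' _ _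
  have hs : star (g : E n →L[ℝ] E n) ((g : E n →L[ℝ] E n) (z : E n)) = z := by
    rw [← mul_apply_eq_comp, Unitary.coe_star_mul_self]
    rfl
  have hz : (basePlane n k).starProjection (z : E n) = 0 :=
    (Submodule.starProjection_apply_eq_zero_iff _).2 z.2
  unfold AffGr.foot
  rw [EuclideanGeometry.orthogonalProjection_apply_mem _ hmem,
    ← Submodule.starProjection_apply, hproj]
  simp [hs, hz]

/-- The push-forward in `affGrMeasure` is along a continuous (hence measurable) map. -/
lemma continuous_movedPlane {n k : ℕ} (hkn : k ≤ n) : Continuous (movedPlane (n := n) hkn) := by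
  refine continuous_induced_rng.2 ?_
  have h : AffGr.code ∘ movedPlane hkn = fun p : OrthGroup n × (basePlane n k)ᗮ =>
      ((p.1 : E n →L[ℝ] E n) * (basePlane n k).starProjection * star (p.1 : E n →L[ℝ] E n),
        (p.1 : E n →L[ℝ] E n) (p.2 : E n)) := funext (movedPlane_code hkn)
  rw [h]
  have h1 : Continuous fun p : OrthGroup n × (basePlane n k)ᗮ => (p.1 : E n →L[ℝ] E n) :=
    continuous_subtype_val.comp continuous_fst
  have h2 : Continuous fun p : OrthGroup n × (basePlane n k)ᗮ => (p.2 : E n) :=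
    continuous_subtype_val.comp continuous_snd
  exact ((h1.mul continuous_const).mul h1.star).prodMk (h1.clm_apply h2)

/-! ### Integration over a plane, volume of a simplex, constants -/

/-- Lebesgue measure `d_τ x` on the affine `k`-plane `τ`, as a measure on `ℝⁿ` carried by `τ`.
(`μHE[k]` is the `k`-dimensional Hausdorff measure, normalized so as to agree with Lebesgue measure
in `ℝᵏ`.) -/
def planeMeasure {n k : ℕ} (τ : AffGr n k) : Measure (E n) :=
  (μHE[k] : Measure (E n)).restrict (τ.1 : Set (E n))

/-- The `q`-dimensional volume `Δ_q` of the convex hull of `x₀, …, x_q`. -/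
def simplexVolume {n q : ℕ} (x : Fin (q + 1) → E n) : ℝ :=
  ((μHE[q] : Measure (E n)) (convexHull ℝ (Set.range x))).toReal

/-- The Siegel gamma function `Γ_k(α) = π^{k(k-1)/4} ∏_{j<k} Γ(α - j/2)`. -/
def siegelGamma (k : ℕ) (α : ℝ) : ℝ :=
  Real.pi ^ ((k : ℝ) * ((k : ℝ) - 1) / 4) * ∏ j ∈ Finset.range k, Real.Gamma (α - (j : ℝ) / 2)

/-- The total mass `σ_{n,k} = 2^k π^{nk/2} / Γ_k(n/2)` of the Stiefel manifold of orthonormal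
`k`-frames in `ℝⁿ`. -/
def stiefelMass (n k : ℕ) : ℝ :=
  2 ^ k * Real.pi ^ ((n : ℝ) * (k : ℝ) / 2) / siegelGamma k ((n : ℝ) / 2)

end BlaschkePetkantschin

end

/-!
The formula is reduced to a statement about functions of `q` vectors of `ℝⁿ` that are invariant
under all isometries, where the average over the orthogonal group disappears:
`lintegral_eq_of_isometryInvariant` says that for such `f ≥ 0` and any isometric embedding
`A : ℝᵏ → ℝⁿ`
`∫ f(x) dx = (σ_{n,q} / σ_{k,q}) ∫ f(A u) ∇(u)^(n-k) du`, with `∇` the volume of the parallelepiped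
(the square root of the Gram determinant). It is proved by induction on `q`. Integrating out all
vectors but the first leaves a radial function, so by polar coordinates the first vector may be put
at `r e₁`, with weight `r^(n-1)` in `ℝⁿ` and `r^(k-1)` in `ℝᵏ`. The other vectors are split into
their first coordinates and their components in `e₁ᗮ`; the function of these components is again
invariant, the induction hypothesis applies to it in dimensions `n - 1` and `k - 1`, and
`∇(r e₁, (t, v)) = r ∇(v)` supplies the missing factor `r^(n-k)`. The areas of the two spheres turn
`σ_{n-1,q-1} / σ_{k-1,q-1}` into `σ_{n,q} / σ_{k,q}`.

Applied to the average of an arbitrary `f ≥ 0` over `O(n)`, this gives the linear formula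
`lintegral_eq_lintegral_orthHaar`. For the affine formula a configuration in the plane `g (ξ₀ + z)`
is written as a base point and `q` difference vectors in `g ξ₀`; the base point in `ξ₀` together with
`z ∈ ξ₀ᗮ` sweeps out `ℝⁿ`, and the linear formula applies to the difference vectors. The volume of
a simplex is `∇ / q!` (`simplexVolume_eq`), whence the factor `(q!)^(n-k)`.

All of this takes place on the parameter space `O(n) × ξ₀ᗮ`. The parametrization of the affine
Grassmannian is a continuous surjection from a Polish space, so a function of the plane is Borel as
soon as it is Borel in the parameters (`measurable_comp_movedPlane_iff`). This carries the formula
over to the affine Grassmannian, first for nonnegative Borel functions, then for integrable ones;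
the formula for the indicator of a null set allows an integrable function to be replaced by a Borel
representative.
-/

namespace BlaschkePetkantschin

open scoped ENNReal RealInnerProductSpace

/-! ### Splitting off the first coordinate -/

/-- The vector `(t, y)` of `ℝ^(m+1)` with first coordinate `t` and remaining coordinates `y`. -/
noncomputable def consE {m : ℕ} (t : ℝ) (y : E m) : E (m + 1) :=
  WithLp.toLp 2 (Fin.cons t y.ofLp)

/-- The vector of `ℝ^m` obtained by dropping the first coordinate. -/
noncomputable def tailE {m : ℕ} (x : E (m + 1)) : E m :=
  WithLp.toLp 2 (fun i => x i.succ)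

@[simp] lemma consE_zero_coord {m : ℕ} (t : ℝ) (y : E m) : consE t y 0 = t := by
  simp [consE]

@[simp] lemma consE_succ_coord {m : ℕ} (t : ℝ) (y : E m) (i : Fin m) :
    consE t y i.succ = y i := by
  simp [consE]

@[simp] lemma tailE_consE {m : ℕ} (t : ℝ) (y : E m) : tailE (consE t y) = y := by
  ext i; simp [tailE]

lemma consE_tailE {m : ℕ} (x : E (m + 1)) : consE (x 0) (tailE x) = x := by
  ext i
  refine Fin.cases ?_ (fun i => ?_) i <;> simp [tailE]

lemma inner_consE {m : ℕ} (s t : ℝ) (x y : E m) :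
    ⟪consE s x, consE t y⟫ = s * t + ⟪x, y⟫ := by
  simp [PiLp.inner_apply, Fin.sum_univ_succ, mul_comm]

lemma norm_consE_zero {m : ℕ} {r : ℝ} (hr : 0 ≤ r) : ‖consE r (0 : E m)‖ = r := by
  rw [@norm_eq_sqrt_real_inner, inner_consE]
  simp [hr]

lemma measurePreserving_consE (m : ℕ) :
    MeasurePreserving (fun p : ℝ × E m => consE p.1 p.2) := by
  have h := (PiLp.volume_preserving_toLp (Fin (m + 1))).comp
    ((volume_preserving_piFinSuccAbove (fun _ : Fin (m + 1) => ℝ) 0).symm.comp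
      ((MeasurePreserving.id (volume : Measure ℝ)).prod (PiLp.volume_preserving_ofLp (Fin m))))
  have e : (fun p : ℝ × E m => consE p.1 p.2) = WithLp.toLp 2 ∘
      (MeasurableEquiv.piFinSuccAbove (fun _ : Fin (m + 1) => ℝ) 0).symm ∘
        Prod.map id WithLp.ofLp := by
    ext p i
    simp [consE]
  rw [e]
  exact h

lemma measurable_consE (m : ℕ) : Measurable (fun p : ℝ × E m => consE p.1 p.2) :=
  (measurePreserving_consE m).measurable

/-- The isometry `(t, y) ↦ (t, A y)` of `ℝ^(k+1)` into `ℝ^(n+1)`. -/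
noncomputable def consIsometry {k n : ℕ} (A : E k →ₗᵢ[ℝ] E n) :
    E (k + 1) →ₗᵢ[ℝ] E (n + 1) where
  toFun x := consE (x 0) (A (tailE x))
  map_add' x y := by
    have h : tailE (x + y) = tailE x + tailE y := by ext i; simp [tailE]
    ext i
    refine Fin.cases ?_ (fun i => ?_) i <;> simp [h]
  map_smul' c x := by
    have h : tailE (c • x) = c • tailE x := by ext i; simp [tailE]
    ext i
    refine Fin.cases ?_ (fun i => ?_) i <;> simp [h]
  norm_map' x := by
    have h : ‖consE (x 0) (A (tailE x))‖ = ‖consE (x 0) (tailE x)‖ := by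
      rw [@norm_eq_sqrt_real_inner, @norm_eq_sqrt_real_inner _ _ _ (consE (x 0) (tailE x)),
        inner_consE, inner_consE, A.inner_map_map]
    rw [consE_tailE] at h
    exact h

@[simp] lemma consIsometry_consE {k n : ℕ} (A : E k →ₗᵢ[ℝ] E n) (t : ℝ) (y : E k) :
    consIsometry A (consE t y) = consE t (A y) := by
  change consE (consE t y 0) (A (tailE (consE t y))) = _
  simp

/-! ### Isometries -/

/-- Two isometric embeddings differ by an isometry of the target. -/
lemma exists_isometry_comp_eq {k n : ℕ} (A B : E k →ₗᵢ[ℝ] E n) :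
    ∃ L : E n →ₗᵢ[ℝ] E n, ∀ x, L (A x) = B x := by
  refine ⟨(B.comp A.equivRange.symm.toLinearIsometry).extend, fun x => ?_⟩
  have h := (B.comp A.equivRange.symm.toLinearIsometry).extend_apply (A.equivRange x)
  simpa using h

/-- Invariance of a function of `q` vectors under the simultaneous action of all linear
isometries. -/
def IsometryInvariant {n q : ℕ} {β : Type*} (f : (Fin q → E n) → β) : Prop :=
  ∀ (L : E n →ₗᵢ[ℝ] E n) (x : Fin q → E n), f (fun i => L (x i)) = f x

lemma IsometryInvariant.comp_eq {k n q : ℕ} {β : Type*} {f : (Fin q → E n) → β}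
    (hf : IsometryInvariant f) (A B : E k →ₗᵢ[ℝ] E n) (u : Fin q → E k) :
    f (fun i => A (u i)) = f (fun i => B (u i)) := by
  obtain ⟨L, hL⟩ := exists_isometry_comp_eq A B
  rw [← hf L]
  simp [hL]

/-- Every linear isometry of `ℝⁿ` preserves Lebesgue measure. -/
lemma measurePreserving_isometry {n : ℕ} (L : E n →ₗᵢ[ℝ] E n) : MeasurePreserving L :=
  (L.toLinearIsometryEquiv rfl).measurePreserving

lemma measurePreserving_isometry_pi {n q : ℕ} (L : E n →ₗᵢ[ℝ] E n) :
    MeasurePreserving (fun (x : Fin q → E n) i => L (x i)) :=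
  volume_preserving_pi fun _ => measurePreserving_isometry L

/-- Every vector is rotated to the first coordinate axis by some isometry. -/
lemma exists_isometry_apply_eq_consE {m : ℕ} (x : E (m + 1)) :
    ∃ L : E (m + 1) →ₗᵢ[ℝ] E (m + 1), L x = consE ‖x‖ 0 :=
  ⟨((Submodule.span ℝ {x - consE ‖x‖ 0})ᗮ.reflection).toLinearIsometry,
    Submodule.reflection_sub (norm_consE_zero (norm_nonneg x)).symm⟩

/-! ### The volume of a parallelepiped -/

/-- The `q`-dimensional volume of the parallelepiped spanned by `u₁, …, u_q`, as the square root of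
the Gram determinant. -/
noncomputable def paraVolume {n q : ℕ} (u : Fin q → E n) : ℝ := √(Matrix.gram ℝ u).det

lemma continuous_paraVolume (n q : ℕ) : Continuous (paraVolume : (Fin q → E n) → ℝ) := by
  refine Real.continuous_sqrt.comp (Continuous.matrix_det ?_)
  refine continuous_matrix fun i j => ?_
  simp only [Matrix.gram_apply]
  fun_prop

lemma paraVolume_nonneg {n q : ℕ} (u : Fin q → E n) : 0 ≤ paraVolume u := Real.sqrt_nonneg _

lemma paraVolume_isometry {k n q : ℕ} (A : E k →ₗᵢ[ℝ] E n) (u : Fin q → E k) :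
    paraVolume (fun i => A (u i)) = paraVolume u := by
  have h : Matrix.gram ℝ (fun i => A (u i)) = Matrix.gram ℝ u := by
    ext i j
    simp [Matrix.gram_apply]
  rw [paraVolume, h, paraVolume]

/-- Base times height: when the first vector is `r e₁`, the first coordinates `t` of the other
vectors do not matter. -/
lemma paraVolume_cons {m q : ℕ} {r : ℝ} (hr : 0 < r) (t : Fin q → ℝ) (v : Fin q → E m) :
    paraVolume (Fin.cons (consE r 0) (fun i => consE (t i) (v i)) : Fin (q + 1) → E (m + 1)) =
      r * paraVolume v := by
  set w : Fin (q + 1) → E (m + 1) := Fin.cons (consE r 0) (fun i => consE (t i) (v i)) with hw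
  -- Row reduction of the Gram matrix with respect to its first row.
  let B : Matrix (Fin (q + 1)) (Fin (q + 1)) ℝ :=
    Matrix.of (Fin.cons (fun j => Matrix.gram ℝ w 0 j)
      (fun i => Fin.cons 0 (fun j => ⟪v i, v j⟫)))
  have hB : (Matrix.gram ℝ w).det = B.det := by
    refine Matrix.det_eq_of_forall_row_eq_smul_add_const (Fin.cons 0 (fun i => t i / r)) 0
      (by simp) fun i j => ?_
    refine Fin.cases ?_ (fun i => ?_) i
    · simp [B]
    · refine Fin.cases ?_ (fun j => ?_) j
      · simp [B, hw, Matrix.gram_apply, inner_consE, norm_consE_zero hr.le]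
        field_simp
      · simp [B, hw, Matrix.gram_apply, inner_consE]
        field_simp
        ring
  have hdet : B.det = r ^ 2 * (Matrix.gram ℝ v).det := by
    rw [Matrix.det_succ_column_zero, Fin.sum_univ_succ]
    have h0 : B 0 0 = r ^ 2 := by simp [B, hw, Matrix.gram_apply, norm_consE_zero hr.le]
    have h1 : B.submatrix Fin.succ Fin.succ = Matrix.gram ℝ v := by
      ext i j
      simp [B, Matrix.gram_apply]
    have h2 : ∀ i : Fin q, B i.succ 0 = 0 := fun i => by simp [B]
    simp [h0, h1, h2]
  rw [paraVolume, hB, hdet, Real.sqrt_mul (sq_nonneg r), Real.sqrt_sq hr.le, paraVolume]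

/-! ### Iterated integrals -/

lemma lintegral_fin_cons {X : Type*} [MeasureSpace X] [SigmaFinite (volume : Measure X)] {q : ℕ}
    {f : (Fin (q + 1) → X) → ℝ≥0∞} (hf : Measurable f) :
    ∫⁻ x, f x = ∫⁻ x : X, ∫⁻ y : Fin q → X, f (Fin.cons x y) := by
  have h := (volume_preserving_piFinSuccAbove (fun _ : Fin (q + 1) => X) 0).symm
  rw [← h.lintegral_comp_emb (MeasurableEquiv.measurableEmbedding _), Measure.volume_eq_prod,
    lintegral_prod]
  · simp [Fin.consEquiv]
  · exact (hf.comp (MeasurableEquiv.measurable _)).aemeasurable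

lemma measurable_fin_cons {X : Type*} [MeasurableSpace X] {q : ℕ} :
    Measurable (fun p : X × (Fin q → X) => (Fin.cons p.1 p.2 : Fin (q + 1) → X)) := by
  refine measurable_pi_lambda _ fun i => ?_
  refine Fin.cases ?_ (fun i => ?_) i
  · simpa using measurable_fst
  · simpa [Function.comp_def] using (measurable_pi_apply i).comp measurable_snd

lemma lintegral_pi_consE {m q : ℕ} {f : (Fin q → E (m + 1)) → ℝ≥0∞} (hf : Measurable f) :
    ∫⁻ x, f x = ∫⁻ t : Fin q → ℝ, ∫⁻ v : Fin q → E m, f (fun i => consE (t i) (v i)) := by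
  have h1 : MeasurePreserving (fun (p : Fin q → ℝ × E m) i => consE (p i).1 (p i).2) :=
    volume_preserving_pi fun _ => measurePreserving_consE m
  have h2 := (volume_measurePreserving_arrowProdEquivProdArrow ℝ (E m) (Fin q)).symm
  have h3 := h1.comp h2
  rw [← h3.lintegral_comp hf, Measure.volume_eq_prod, lintegral_prod]
  · rfl
  · exact (hf.comp h3.measurable).aemeasurable

/-! ### Polar coordinates -/

/-- The surface area `2 π^{n/2} / Γ(n/2)` of the unit sphere of `ℝⁿ`. -/
noncomputable def sphereArea (n : ℕ) : ℝ :=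
  2 * Real.pi ^ ((n : ℝ) / 2) / Real.Gamma ((n : ℝ) / 2)

lemma sphereArea_pos {n : ℕ} (hn : 0 < n) : 0 < sphereArea n := by
  have : 0 < Real.Gamma ((n : ℝ) / 2) := Real.Gamma_pos_of_pos (by positivity)
  unfold sphereArea
  positivity

lemma toSphere_univ (m : ℕ) :
    (volume : Measure (E (m + 1))).toSphere Set.univ = ENNReal.ofReal (sphereArea (m + 1)) := by
  rw [Measure.toSphere_apply_univ, EuclideanSpace.volume_ball]
  simp only [finrank_euclideanSpace, Fintype.card_fin, ENNReal.ofReal_one, one_pow, one_mul]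
  rw [← ENNReal.ofReal_natCast, ← ENNReal.ofReal_mul (by positivity)]
  congr 1
  have h0 : (((m + 1 : ℕ) : ℝ)) / 2 ≠ 0 := by positivity
  have hg : Real.Gamma (((m + 1 : ℕ) : ℝ) / 2) ≠ 0 :=
    (Real.Gamma_pos_of_pos (by positivity)).ne'
  rw [Real.Gamma_add_one h0, Real.sqrt_eq_rpow, ← Real.rpow_natCast, ← Real.rpow_mul Real.pi_pos.le,
    sphereArea]
  have h1 : (1 / 2 : ℝ) * ((m + 1 : ℕ) : ℝ) = ((m + 1 : ℕ) : ℝ) / 2 := by ring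
  rw [h1]
  have h2 : ((m + 1 : ℕ) : ℝ) ≠ 0 := by positivity
  field_simp

lemma lintegral_norm {m : ℕ} {f : ℝ → ℝ≥0∞} (hf : Measurable f) :
    ∫⁻ x : E (m + 1), f ‖x‖ = ENNReal.ofReal (sphereArea (m + 1)) *
      ∫⁻ r in Set.Ioi (0 : ℝ), ENNReal.ofReal (r ^ m) * f r := by
  have hp := (volume : Measure (E (m + 1))).measurePreserving_homeomorphUnitSphereProd
  have hd : Module.finrank ℝ (E (m + 1)) - 1 = m := by simp
  rw [hd] at hp
  have h1 : ∫⁻ x : E (m + 1), f ‖x‖ =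
      ∫⁻ x : ({0}ᶜ : Set (E (m + 1))), f ‖(x : E (m + 1))‖ ∂(volume.comap Subtype.val) := by
    rw [lintegral_subtype_comap (measurableSet_singleton _).compl (fun x : E (m + 1) => f ‖x‖),
      restrict_compl_singleton]
  have h2 := hp.lintegral_comp_emb (Homeomorph.measurableEmbedding _)
    (fun p : Metric.sphere (0 : E (m + 1)) 1 × Set.Ioi (0 : ℝ) => f p.2)
  simp only [homeomorphUnitSphereProd_apply_snd_coe] at h2
  have hfm : Measurable
      fun p : Metric.sphere (0 : E (m + 1)) 1 × Set.Ioi (0 : ℝ) => f p.2 := by fun_prop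
  rw [h1, h2, lintegral_prod _ hfm.aemeasurable]
  dsimp only
  rw [lintegral_const, toSphere_univ, mul_comm, Measure.volumeIoiPow,
    lintegral_withDensity_eq_lintegral_mul _ (by fun_prop) (by fun_prop)]
  congr 1
  exact lintegral_subtype_comap measurableSet_Ioi (fun r : ℝ => ENNReal.ofReal (r ^ m) * f r)

/-- Polar coordinates for a function which is invariant under isometries. -/
lemma lintegral_radial {m : ℕ} {g : E (m + 1) → ℝ≥0∞} (hg : Measurable g)
    (hinv : ∀ (L : E (m + 1) →ₗᵢ[ℝ] E (m + 1)) x, g (L x) = g x) :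
    ∫⁻ x, g x = ENNReal.ofReal (sphereArea (m + 1)) *
      ∫⁻ r in Set.Ioi (0 : ℝ), ENNReal.ofReal (r ^ m) * g (consE r 0) := by
  rw [← lintegral_norm (f := fun r => g (consE r 0))
    (hg.comp ((measurable_consE m).comp measurable_prodMk_right))]
  refine lintegral_congr fun x => ?_
  obtain ⟨L, hL⟩ := exists_isometry_apply_eq_consE x
  rw [← hL, hinv]

/-! ### The constants -/

lemma siegelGamma_pos {n q : ℕ} (hqn : q ≤ n) : 0 < siegelGamma q ((n : ℝ) / 2) := by
  unfold siegelGamma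
  refine mul_pos (Real.rpow_pos_of_pos Real.pi_pos _) (Finset.prod_pos fun j hj => ?_)
  refine Real.Gamma_pos_of_pos ?_
  have : (j : ℝ) < n := by exact_mod_cast (Finset.mem_range.1 hj).trans_le hqn
  linarith

lemma stiefelMass_pos {n q : ℕ} (hqn : q ≤ n) : 0 < stiefelMass n q :=
  div_pos (mul_pos (by positivity) (Real.rpow_pos_of_pos Real.pi_pos _)) (siegelGamma_pos hqn)

lemma stiefelMass_zero_right (n : ℕ) : stiefelMass n 0 = 1 := by
  simp [stiefelMass, siegelGamma]

/-- Choosing the first vector of a frame on the sphere and the others in its orthogonal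
complement. -/
lemma stiefelMass_succ {n q : ℕ} (hqn : q ≤ n) :
    stiefelMass (n + 1) (q + 1) = sphereArea (n + 1) * stiefelMass n q := by
  have hg : Real.Gamma (((n : ℝ) + 1) / 2) ≠ 0 := (Real.Gamma_pos_of_pos (by positivity)).ne'
  have hs := (siegelGamma_pos hqn).ne'
  have h1 : siegelGamma (q + 1) (((n + 1 : ℕ) : ℝ) / 2) =
      Real.pi ^ ((q : ℝ) / 2) * Real.Gamma (((n : ℝ) + 1) / 2) * siegelGamma q ((n : ℝ) / 2) := by
    unfold siegelGamma
    rw [Finset.prod_range_succ']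
    have e1 : ((q + 1 : ℕ) : ℝ) * (((q + 1 : ℕ) : ℝ) - 1) / 4 =
        (q : ℝ) / 2 + (q : ℝ) * ((q : ℝ) - 1) / 4 := by push_cast; ring
    have e2 : ∀ j : ℕ, ((n + 1 : ℕ) : ℝ) / 2 - ((j + 1 : ℕ) : ℝ) / 2 = (n : ℝ) / 2 - (j : ℝ) / 2 :=
      fun j => by push_cast; ring
    rw [e1, Real.rpow_add Real.pi_pos]
    simp only [e2]
    push_cast
    simp only [zero_div, sub_zero]
    ring
  have h2 : Real.pi ^ (((n + 1 : ℕ) : ℝ) * ((q + 1 : ℕ) : ℝ) / 2) =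
      Real.pi ^ ((q : ℝ) / 2) * Real.pi ^ (((n : ℝ) + 1) / 2) *
        Real.pi ^ ((n : ℝ) * (q : ℝ) / 2) := by
    rw [← Real.rpow_add Real.pi_pos, ← Real.rpow_add Real.pi_pos]
    congr 1
    push_cast
    ring
  have h3 : Real.pi ^ ((q : ℝ) / 2) ≠ 0 := (Real.rpow_pos_of_pos Real.pi_pos _).ne'
  unfold stiefelMass sphereArea
  rw [h1, h2]
  push_cast
  field_simp
  ring

/-! ### The linear formula for isometry-invariant functions -/

/-- Orthonormal coordinates on the base plane. -/
noncomputable def baseIso {n k : ℕ} (hkn : k ≤ n) : E k ≃ₗᵢ[ℝ] basePlane n k :=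
  ((stdOrthonormalBasis ℝ (basePlane n k)).reindex
    (finCongr (finrank_basePlane hkn))).repr.symm

/-- The isometric embedding of `ℝᵏ` onto the base plane of `ℝⁿ`. -/
noncomputable def baseEmb {n k : ℕ} (hkn : k ≤ n) : E k →ₗᵢ[ℝ] E n :=
  (basePlane n k).subtypeₗᵢ.comp (baseIso hkn).toLinearIsometry

lemma baseEmb_apply {n k : ℕ} (hkn : k ≤ n) (x : E k) :
    baseEmb hkn x = (baseIso hkn x : E n) := rfl

lemma fin_cons_map {X Y : Type*} {q : ℕ} (L : X → Y) (x : X) (y : Fin q → X) :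
    (Fin.cons (L x) (fun i => L (y i)) : Fin (q + 1) → Y) =
      fun i => L ((Fin.cons x y : Fin (q + 1) → X) i) := by
  funext i
  refine Fin.cases ?_ (fun i => ?_) i <;> simp

/-- The integral of an isometry-invariant function of `q + 1` vectors is a radial integral over the
first vector, which may therefore be taken on the first coordinate axis. -/
lemma lintegral_fin_succ_of_isometryInvariant {m q : ℕ} {g : (Fin (q + 1) → E (m + 1)) → ℝ≥0∞}
    (hg : Measurable g) (hinv : IsometryInvariant g) :
    ∫⁻ x, g x = ENNReal.ofReal (sphereArea (m + 1)) *
      ∫⁻ r in Set.Ioi (0 : ℝ), ENNReal.ofReal (r ^ m) *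
        ∫⁻ t : Fin q → ℝ, ∫⁻ v : Fin q → E m,
          g (Fin.cons (consE r 0) (fun i => consE (t i) (v i))) := by
  have hgc : Measurable fun p : E (m + 1) × (Fin q → E (m + 1)) => g (Fin.cons p.1 p.2) :=
    hg.comp measurable_fin_cons
  rw [lintegral_fin_cons hg, lintegral_radial hgc.lintegral_prod_right']
  · congr 1
    refine lintegral_congr fun r => ?_
    congr 1
    exact lintegral_pi_consE (hgc.comp measurable_prodMk_left)
  · intro L x
    have := (measurePreserving_isometry_pi (q := q) L).lintegral_comp
      (f := fun y => g (Fin.cons (L x) y)) (hgc.comp measurable_prodMk_left)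
    dsimp only
    rw [← this]
    simp only [fin_cons_map, hinv L]

/-- The linear Blaschke–Petkantschin formula for functions invariant under isometries. All linear
`k`-planes contribute equally, so a single one, the range of `A`, stands for their average. -/
theorem lintegral_eq_of_isometryInvariant {q k n : ℕ} (hqk : q ≤ k) (hkn : k ≤ n)
    (A : E k →ₗᵢ[ℝ] E n) {f : (Fin q → E n) → ℝ≥0∞} (hf : Measurable f)
    (hinv : IsometryInvariant f) :
    ∫⁻ x, f x = ENNReal.ofReal (stiefelMass n q / stiefelMass k q) *
      ∫⁻ u : Fin q → E k, ENNReal.ofReal (paraVolume u ^ (n - k)) * f (fun i => A (u i)) := by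
  induction q generalizing k n with
  | zero =>
    have h0 : ∀ {m : ℕ} (g : (Fin 0 → E m) → ℝ≥0∞), ∫⁻ x, g x = g 0 := fun g => by
      rw [lintegral_unique, volume_pi, Measure.pi_of_empty]
      simp [Subsingleton.elim (default : Fin 0 → E _) 0]
    rw [h0, h0, stiefelMass_zero_right, stiefelMass_zero_right]
    have : f (fun i => A ((0 : Fin 0 → E k) i)) = f 0 := congrArg f (Subsingleton.elim _ _)
    rw [this]
    simp [paraVolume]
  | succ q ih =>
    obtain ⟨k, rfl⟩ : ∃ k', k = k' + 1 := ⟨k - 1, by omega⟩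
    obtain ⟨n, rfl⟩ : ∃ n', n = n' + 1 := ⟨n - 1, by omega⟩
    have hqk' : q ≤ k := by omega
    have hkn' : k ≤ n := by omega
    let A' : E k →ₗᵢ[ℝ] E n := baseEmb hkn'
    have hsub : n + 1 - (k + 1) = n - k := by omega
    simp only [hinv.comp_eq A (consIsometry A'), hsub]
    set w : (Fin (q + 1) → E (k + 1)) → ℝ≥0∞ := fun u =>
      ENNReal.ofReal (paraVolume u ^ (n - k)) * f (fun i => consIsometry A' (u i)) with hw
    have hwm : Measurable w := by
      refine Measurable.mul ?_ (hf.comp ?_)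
      · exact ((continuous_paraVolume _ _).measurable.pow_const _).ennreal_ofReal
      · exact measurable_pi_lambda _ fun i =>
          (consIsometry A').continuous.measurable.comp (measurable_pi_apply i)
    have hwinv : IsometryInvariant w := by
      intro L u
      simp only [hw, paraVolume_isometry]
      congr 1
      exact hinv.comp_eq ((consIsometry A').comp L) (consIsometry A') u
    rw [lintegral_fin_succ_of_isometryInvariant hf hinv,
      lintegral_fin_succ_of_isometryInvariant hwm hwinv,
      stiefelMass_succ (hqk'.trans hkn'), stiefelMass_succ hqk']
    set C := stiefelMass n q / stiefelMass k q with hC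
    have hCpos : 0 < C := div_pos (stiefelMass_pos (hqk'.trans hkn')) (stiefelMass_pos hqk')
    have hS : sphereArea (n + 1) * stiefelMass n q / (sphereArea (k + 1) * stiefelMass k q) =
        sphereArea (n + 1) / sphereArea (k + 1) * C := by
      rw [hC, mul_div_mul_comm]
    have hSk := sphereArea_pos k.succ_pos
    have hSn := sphereArea_pos n.succ_pos
    have hcoef : ENNReal.ofReal (sphereArea (n + 1) / sphereArea (k + 1) * C) *
        ENNReal.ofReal (sphereArea (k + 1)) =
          ENNReal.ofReal (sphereArea (n + 1)) * ENNReal.ofReal C := by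
      rw [← ENNReal.ofReal_mul (by positivity), ← ENNReal.ofReal_mul hSn.le]
      congr 1
      field_simp
    rw [hS, ← mul_assoc, hcoef, mul_assoc]
    congr 1
    rw [← lintegral_const_mul' _ _ ENNReal.ofReal_ne_top]
    refine setLIntegral_congr_fun measurableSet_Ioi fun r (hr : 0 < r) => ?_
    -- The induction hypothesis is applied in the orthogonal complement of the first vector.
    have hih : ∀ t : Fin q → ℝ, ∫⁻ v : Fin q → E n,
        f (Fin.cons (consE r 0) (fun i => consE (t i) (v i))) =
          ENNReal.ofReal C * ∫⁻ v : Fin q → E k, ENNReal.ofReal (paraVolume v ^ (n - k)) *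
            f (Fin.cons (consE r 0) (fun i => consE (t i) (A' (v i)))) := by
      intro t
      refine ih hqk' hkn' A' (f := fun v => f (Fin.cons (consE r 0) (fun i => consE (t i) (v i))))
        ?_ ?_
      · refine hf.comp (measurable_fin_cons.comp (measurable_const.prodMk ?_))
        exact measurable_pi_lambda _ fun i =>
          (measurable_consE n).comp (measurable_const.prodMk (measurable_pi_apply i))
      · intro L v
        dsimp only
        rw [← hinv (consIsometry L) (Fin.cons (consE r 0) (fun i => consE (t i) (v i))),
          ← fin_cons_map]
        simp
    have hwval : ∀ (t : Fin q → ℝ) (v : Fin q → E k),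
        w (Fin.cons (consE r 0) (fun i => consE (t i) (v i))) =
          ENNReal.ofReal (r ^ (n - k)) * (ENNReal.ofReal (paraVolume v ^ (n - k)) *
            f (Fin.cons (consE r 0) (fun i => consE (t i) (A' (v i))))) := by
      intro t v
      have : (fun i => consIsometry A' ((Fin.cons (consE r 0) (fun i => consE (t i) (v i)) :
          Fin (q + 1) → E (k + 1)) i)) =
            Fin.cons (consE r 0) (fun i => consE (t i) (A' (v i))) := by
        rw [← fin_cons_map]
        simp
      simp only [hw, this, paraVolume_cons hr, mul_pow]
      rw [ENNReal.ofReal_mul (by positivity), mul_assoc]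
    simp only [hih, hwval, lintegral_const_mul' _ _ ENNReal.ofReal_ne_top]
    have hrn : ENNReal.ofReal (r ^ n) = ENNReal.ofReal (r ^ k) * ENNReal.ofReal (r ^ (n - k)) := by
      rw [← ENNReal.ofReal_mul (by positivity), ← pow_add, Nat.add_sub_cancel' hkn']
    rw [hrn]
    ring

/-! ### The volume of a simplex -/

/-- The simplex with vertices `0, t e₁, …, t e_q`. -/
def cornerSimplex (q : ℕ) (t : ℝ) : Set (Fin q → ℝ) := {y | (∀ i, 0 ≤ y i) ∧ ∑ i, y i ≤ t}

lemma measurableSet_cornerSimplex (q : ℕ) (t : ℝ) : MeasurableSet (cornerSimplex q t) := by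
  refine MeasurableSet.inter ?_
    (measurableSet_le (f := fun y : Fin q → ℝ => ∑ i, y i) (by fun_prop) measurable_const)
  change MeasurableSet {y : Fin q → ℝ | ∀ i, 0 ≤ y i}
  rw [Set.ofPred_forall]
  exact MeasurableSet.iInter fun i => measurableSet_le measurable_const (measurable_pi_apply i)

lemma volume_cornerSimplex (q : ℕ) {t : ℝ} (ht : 0 ≤ t) :
    volume (cornerSimplex q t) = ENNReal.ofReal (t ^ q / q.factorial) := by
  induction q generalizing t with
  | zero =>
    have : cornerSimplex 0 t = Set.univ := by
      ext y
      simp [cornerSimplex, ht]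
    rw [this, volume_pi, Measure.pi_of_empty]
    simp
  | succ q ih =>
    have hcons : ∀ (s : ℝ) (y : Fin q → ℝ),
        (cornerSimplex (q + 1) t).indicator (1 : (Fin (q + 1) → ℝ) → ℝ≥0∞) (Fin.cons s y) =
          (Set.Icc 0 t).indicator (fun s => (cornerSimplex q (t - s)).indicator 1 y) s := by
      intro s y
      have hiff : (Fin.cons s y : Fin (q + 1) → ℝ) ∈ cornerSimplex (q + 1) t ↔
          s ∈ Set.Icc 0 t ∧ y ∈ cornerSimplex q (t - s) := by
        simp only [cornerSimplex, Set.mem_ofPred_eq, Fin.forall_fin_succ, Fin.cons_zero,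
          Fin.cons_succ, Fin.sum_univ_succ, Set.mem_Icc]
        constructor
        · rintro ⟨⟨h0, h1⟩, h2⟩
          have := Finset.sum_nonneg fun i (_ : i ∈ Finset.univ) => h1 i
          exact ⟨⟨h0, by linarith⟩, h1, by linarith⟩
        · rintro ⟨⟨h0, -⟩, h1, h2⟩
          exact ⟨⟨h0, h1⟩, by linarith⟩
      by_cases hs : s ∈ Set.Icc 0 t <;> by_cases hy : y ∈ cornerSimplex q (t - s) <;>
        simp [Set.indicator, hiff, hs, hy]
    rw [← lintegral_indicator_one (measurableSet_cornerSimplex _ _), lintegral_fin_cons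
      (measurable_one.indicator (measurableSet_cornerSimplex _ _))]
    have hin : ∀ s : ℝ, ∫⁻ y : Fin q → ℝ,
        (cornerSimplex (q + 1) t).indicator (1 : (Fin (q + 1) → ℝ) → ℝ≥0∞) (Fin.cons s y) =
          (Set.Icc 0 t).indicator (fun s => ENNReal.ofReal ((t - s) ^ q / q.factorial)) s := by
      intro s
      simp only [hcons]
      by_cases hs : s ∈ Set.Icc 0 t
      · simp only [Set.indicator_of_mem hs]
        rw [lintegral_indicator_one (measurableSet_cornerSimplex _ _), ih (by linarith [hs.2])]
      · simp [Set.indicator_of_notMem hs]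
    simp only [hin]
    rw [lintegral_indicator measurableSet_Icc, ← ofReal_integral_eq_lintegral_ofReal]
    · congr 1
      rw [integral_Icc_eq_integral_Ioc, ← intervalIntegral.integral_of_le ht,
        intervalIntegral.integral_comp_sub_left (fun s : ℝ => s ^ q / q.factorial),
        intervalIntegral.integral_div, integral_pow, Nat.factorial_succ]
      push_cast
      simp
      field_simp
    · exact (Continuous.continuousOn (by fun_prop)).integrableOn_compact isCompact_Icc
    · filter_upwards [ae_restrict_mem measurableSet_Icc] with s hs
      have : 0 ≤ t - s := by linarith [hs.2]
      simp only [Pi.zero_apply]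
      positivity

/-- The linear map `ℝ^q → ℝⁿ` sending the standard basis to the given vectors. -/
noncomputable def spanMap {n q : ℕ} (u : Fin q → E n) : E q →ₗ[ℝ] E n :=
  (EuclideanSpace.basisFun (Fin q) ℝ).toBasis.constr ℝ u

lemma spanMap_apply {n q : ℕ} (u : Fin q → E n) (y : E q) :
    spanMap u y = ∑ i, y i • u i := by
  simp [spanMap, Module.Basis.constr_apply_fintype]

lemma normDet_spanMap {n q : ℕ} (u : Fin q → E n) : (spanMap u).normDet = paraVolume u := by
  have h := (spanMap u).normDet_sq_eq_det_gram (EuclideanSpace.basisFun (Fin q) ℝ)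
  have e : (fun i => spanMap u (EuclideanSpace.basisFun (Fin q) ℝ i)) = u := by
    funext i
    simp [spanMap_apply]
  rw [e] at h
  rw [paraVolume, ← h]
  exact (Real.sqrt_sq (spanMap u).normDet_nonneg).symm

lemma convexHull_range_eq_image_cornerSimplex {n q : ℕ} (x : Fin (q + 1) → E n) :
    convexHull ℝ (Set.range x) = (fun v => x 0 + v) ''
      (spanMap (fun i => x i.succ - x 0) '' (WithLp.ofLp ⁻¹' cornerSimplex q 1)) := by
  have h1 : Set.range x = Fintype.linearCombination ℝ x '' Set.range (fun i => Pi.single i 1) := by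
    rw [← Set.range_comp]
    congr 1
    funext i
    simp [Fintype.linearCombination_apply_single]
  have key : ∀ w : Fin (q + 1) → ℝ, ∑ i, w i = 1 →
      ∑ i, w i • x i = x 0 + ∑ i : Fin q, w i.succ • (x i.succ - x 0) := by
    intro w hw
    rw [Fin.sum_univ_succ] at hw
    rw [Fin.sum_univ_succ, eq_sub_of_add_eq hw]
    simp only [smul_sub, Finset.sum_sub_distrib, sub_smul, one_smul, ← Finset.sum_smul]
    abel
  rw [h1, ← LinearMap.image_convexHull, convexHull_rangle_single_eq_stdSimplex]
  ext p
  constructor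
  · rintro ⟨w, ⟨hw0, hw1⟩, rfl⟩
    refine ⟨_, ⟨WithLp.toLp 2 (fun i => w i.succ), ⟨fun i => hw0 _, ?_⟩, rfl⟩, ?_⟩
    · rw [Fin.sum_univ_succ] at hw1
      change ∑ i : Fin q, w i.succ ≤ 1
      linarith [hw0 0]
    · simp [spanMap_apply, Fintype.linearCombination_apply, key w hw1]
  · rintro ⟨_, ⟨y, ⟨hy0, hy1⟩, rfl⟩, rfl⟩
    have hw1 : ∑ i, (Fin.cons (1 - ∑ i, y i) y.ofLp : Fin (q + 1) → ℝ) i = 1 := by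
      simp [Fin.sum_univ_succ]
    refine ⟨Fin.cons (1 - ∑ i, y i) y.ofLp, ⟨fun i => ?_, hw1⟩, ?_⟩
    · refine Fin.cases ?_ (fun i => ?_) i
      · simpa using hy1
      · simpa using hy0 i
    · rw [Fintype.linearCombination_apply, key _ hw1]
      simp [spanMap_apply]

lemma simplexVolume_eq {n q : ℕ} (x : Fin (q + 1) → E n) :
    simplexVolume x = paraVolume (fun i => x i.succ - x 0) / q.factorial := by
  have h := (spanMap (fun i => x i.succ - x 0)).euclideanHausdorffMeasure_image_eq_normDet_mul_volume
    (WithLp.ofLp ⁻¹' cornerSimplex q 1)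
  rw [(PiLp.volume_preserving_ofLp (Fin q)).measure_preimage
    (measurableSet_cornerSimplex _ _).nullMeasurableSet, volume_cornerSimplex q zero_le_one,
    normDet_spanMap, finrank_euclideanSpace, Fintype.card_fin,
    ← ENNReal.ofReal_mul (paraVolume_nonneg _), one_pow, mul_one_div] at h
  rw [simplexVolume, convexHull_range_eq_image_cornerSimplex,
    (isometry_add_left (x 0)).euclideanHausdorffMeasure_image, h, ENNReal.toReal_ofReal]
  exact div_nonneg (paraVolume_nonneg _) (by positivity)

/-! ### Averaging over the orthogonal group -/

instance (n : ℕ) : (orthHaar n).IsHaarMeasure := by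
  unfold orthHaar
  infer_instance

instance (n : ℕ) : IsProbabilityMeasure (orthHaar n) := by
  refine ⟨?_⟩
  have := Measure.haarMeasure_self (G := OrthGroup n) (K₀ := ⊤)
  simpa [orthHaar] using this

/-- The orthogonal group is compact, hence unimodular. -/
instance (n : ℕ) : (orthHaar n).IsMulRightInvariant := by
  refine ⟨fun g => ?_⟩
  have hprob : IsProbabilityMeasure ((orthHaar n).map (· * g)) :=
    Measure.isProbabilityMeasure_map (measurable_mul_const g).aemeasurable
  have h := Measure.isMulInvariant_eq_smul_of_compactSpace ((orthHaar n).map (· * g)) (orthHaar n)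
  have h1 := congrArg (fun μ => μ Set.univ) h
  simp only [measure_univ, Measure.smul_apply, smul_eq_mul, ENNReal.smul_def, mul_one] at h1
  rw [h, ENNReal.smul_def, ← h1, one_smul]

/-- An element of the orthogonal group, as a linear isometry. -/
noncomputable def orthIsometry {n : ℕ} (g : OrthGroup n) : E n →ₗᵢ[ℝ] E n :=
  (Unitary.linearIsometryEquiv g).toLinearIsometry

@[simp] lemma orthIsometry_apply {n : ℕ} (g : OrthGroup n) (x : E n) :
    orthIsometry g x = (g : E n →L[ℝ] E n) x := rfl

lemma exists_orthGroup_eq {n : ℕ} (L : E n →ₗᵢ[ℝ] E n) :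
    ∃ g : OrthGroup n, ∀ x, (g : E n →L[ℝ] E n) x = L x :=
  ⟨Unitary.linearIsometryEquiv.symm (L.toLinearIsometryEquiv rfl), fun _ => rfl⟩

lemma measurable_orthGroup_apply (n : ℕ) :
    Measurable (fun p : OrthGroup n × E n => (p.1 : E n →L[ℝ] E n) p.2) := by
  refine Continuous.measurable ?_
  exact (continuous_subtype_val.comp continuous_fst).clm_apply continuous_snd

lemma measurable_orthGroup_pi (n q : ℕ) :
    Measurable (fun (p : OrthGroup n × (Fin q → E n)) i => (p.1 : E n →L[ℝ] E n) (p.2 i)) :=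
  measurable_pi_lambda _ fun i => (measurable_orthGroup_apply n).comp
    (measurable_fst.prodMk ((measurable_pi_apply i).comp measurable_snd))

lemma isometryInvariant_average {n q : ℕ} {f : (Fin q → E n) → ℝ≥0∞} :
    IsometryInvariant fun x =>
      ∫⁻ g, f (fun i => (g : E n →L[ℝ] E n) (x i)) ∂(orthHaar n) := by
  intro L x
  obtain ⟨h, hh⟩ := exists_orthGroup_eq L
  dsimp only
  rw [← lintegral_mul_right_eq_self
    (fun g : OrthGroup n => f (fun i => (g : E n →L[ℝ] E n) (x i))) h]
  simp only [← hh]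
  rfl

/-- The linear Blaschke–Petkantschin formula: `gξ₀` runs through the linear `k`-planes. -/
theorem lintegral_eq_lintegral_orthHaar {q k n : ℕ} (hqk : q ≤ k) (hkn : k ≤ n)
    {f : (Fin q → E n) → ℝ≥0∞} (hf : Measurable f) :
    ∫⁻ x, f x = ENNReal.ofReal (stiefelMass n q / stiefelMass k q) *
      ∫⁻ g : OrthGroup n, (∫⁻ u : Fin q → E k, ENNReal.ofReal (paraVolume u ^ (n - k)) *
        f (fun i => (g : E n →L[ℝ] E n) (baseEmb hkn (u i)))) ∂(orthHaar n) := by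
  have hm : Measurable fun p : OrthGroup n × (Fin q → E n) =>
      f (fun i => (p.1 : E n →L[ℝ] E n) (p.2 i)) := hf.comp (measurable_orthGroup_pi n q)
  have hA : Measurable fun (u : Fin q → E k) i => baseEmb hkn (u i) :=
    measurable_pi_lambda _ fun i =>
      (baseEmb hkn).continuous.measurable.comp (measurable_pi_apply i)
  have hw : Measurable fun u : Fin q → E k => ENNReal.ofReal (paraVolume u ^ (n - k)) :=
    ((continuous_paraVolume k q).measurable.pow_const _).ennreal_ofReal
  have h1 : ∫⁻ x, f x = ∫⁻ x : Fin q → E n,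
      ∫⁻ g, f (fun i => (g : E n →L[ℝ] E n) (x i)) ∂(orthHaar n) := by
    rw [lintegral_lintegral_swap
      (f := fun (x : Fin q → E n) (g : OrthGroup n) => f (fun i => (g : E n →L[ℝ] E n) (x i)))
      (hm.comp measurable_swap).aemeasurable]
    have : ∀ g : OrthGroup n, ∫⁻ x : Fin q → E n, f (fun i => (g : E n →L[ℝ] E n) (x i)) = ∫⁻ x, f x :=
      fun g => (measurePreserving_isometry_pi (orthIsometry g)).lintegral_comp hf
    simp [this]
  rw [h1, lintegral_eq_of_isometryInvariant hqk hkn (baseEmb hkn) hm.lintegral_prod_left'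
    isometryInvariant_average, lintegral_lintegral_swap]
  · congr 1
    refine lintegral_congr fun u => ?_
    exact (lintegral_const_mul _ (hm.comp measurable_prodMk_right)).symm
  · exact ((hw.comp measurable_snd).mul
      (hm.comp (measurable_fst.prodMk (hA.comp measurable_snd)))).aemeasurable

/-! ### The affine formula for nonnegative functions -/

/-- `ℝⁿ` is the orthogonal sum of the base plane and its orthogonal complement. -/
lemma measurePreserving_baseEmb_add {n k : ℕ} (hkn : k ≤ n) :
    MeasurePreserving (fun p : E k × (basePlane n k)ᗮ => baseEmb hkn p.1 + (p.2 : E n)) := by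
  have h1 := ((basePlane n k).measurePreserving_measurableEquivProd (0 : E n)).symm
  rw [InnerProductSpace.euclideanHausdorffMeasure_eq_volume] at h1
  have h2 := h1.comp ((baseIso hkn).measurePreserving.prod
    (MeasurePreserving.id (volume : Measure (basePlane n k)ᗮ)))
  have e : (fun p : E k × (basePlane n k)ᗮ => baseEmb hkn p.1 + (p.2 : E n)) =
      ((basePlane n k).measurableEquivProd (0 : E n)).symm ∘ Prod.map (baseIso hkn) id := by
    funext p
    simp [baseEmb_apply]
  rw [e]
  exact h2

/-- Referring all points of a configuration to the first one. -/
lemma lintegral_fin_succ_eq_translate {m q : ℕ} {f : (Fin (q + 1) → E m) → ℝ≥0∞}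
    (hf : Measurable f) :
    ∫⁻ x, f x = ∫⁻ y : E m, ∫⁻ u : Fin q → E m, f (Fin.cons y (fun i => y + u i)) := by
  rw [lintegral_fin_cons hf]
  refine lintegral_congr fun y => ?_
  exact (lintegral_add_left_eq_self (fun v : Fin q → E m => f (Fin.cons y v)) (fun _ => y)).symm

lemma simplexVolume_translate {m q : ℕ} (y : E m) (u : Fin q → E m) :
    simplexVolume (Fin.cons y (fun i => y + u i) : Fin (q + 1) → E m) =
      paraVolume u / q.factorial := by
  rw [simplexVolume_eq]
  simp

lemma measurable_simplexVolume (m q : ℕ) :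
    Measurable (simplexVolume : (Fin (q + 1) → E m) → ℝ) := by
  have : (simplexVolume : (Fin (q + 1) → E m) → ℝ) =
      fun x => paraVolume (fun i => x i.succ - x 0) / q.factorial := funext simplexVolume_eq
  rw [this]
  refine ((continuous_paraVolume m q).comp ?_).measurable.div_const _
  fun_prop

lemma simplexVolume_nonneg {m q : ℕ} (x : Fin (q + 1) → E m) : 0 ≤ simplexVolume x :=
  ENNReal.toReal_nonneg

/-- The constant of the affine Blaschke–Petkantschin formula. -/
noncomputable def bpConst (n k q : ℕ) : ℝ :=
  (q.factorial : ℝ) ^ (n - k) * stiefelMass n q / stiefelMass k q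

/-- The points `g (x i + z)` of the plane `g (ξ₀ + z)`, for `p = (g, z)` and points `x i` of the
base plane `ξ₀`, the latter given by their coordinates in `ℝᵏ`. -/
noncomputable def placePoints {n k q : ℕ} (hkn : k ≤ n) (p : OrthGroup n × (basePlane n k)ᗮ)
    (x : Fin (q + 1) → E k) : Fin (q + 1) → E n :=
  fun i => (p.1 : E n →L[ℝ] E n) (baseEmb hkn (x i) + p.2)

lemma measurable_placePoints {n k q : ℕ} (hkn : k ≤ n) :
    Measurable fun p : (OrthGroup n × (basePlane n k)ᗮ) × (Fin (q + 1) → E k) =>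
      placePoints hkn p.1 p.2 := by
  refine measurable_pi_lambda _ fun i => (measurable_orthGroup_apply n).comp
    ((measurable_fst.comp measurable_fst).prodMk (Measurable.add ?_ ?_))
  · exact (baseEmb hkn).continuous.measurable.comp ((measurable_pi_apply i).comp measurable_snd)
  · exact measurable_subtype_coe.comp (measurable_snd.comp measurable_fst)

/-- The affine Blaschke–Petkantschin formula for nonnegative functions, on the parameter space of
the affine Grassmannian. -/
theorem lintegral_eq_lintegral_placePoints {q k n : ℕ} (hqk : q ≤ k) (hkn : k ≤ n)
    {f : (Fin (q + 1) → E n) → ℝ≥0∞} (hf : Measurable f) :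
    ∫⁻ x, f x = ENNReal.ofReal (bpConst n k q) *
      ∫⁻ p, (∫⁻ x : Fin (q + 1) → E k, ENNReal.ofReal (simplexVolume x ^ (n - k)) *
        f (placePoints hkn p x)) ∂((orthHaar n).prod (volume : Measure (basePlane n k)ᗮ)) := by
  set w : (Fin q → E k) → ℝ≥0∞ :=
    fun u => ENNReal.ofReal ((paraVolume u / q.factorial) ^ (n - k)) with hw
  have hwm : Measurable w :=
    (((continuous_paraVolume k q).measurable.div_const _).pow_const _).ennreal_ofReal
  -- The integral over configurations based at `y`, in the direction `g ξ₀`.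
  set K : OrthGroup n → E n → ℝ≥0∞ := fun g y => ∫⁻ u : Fin q → E k, w u *
    f (Fin.cons y (fun i => y + (g : E n →L[ℝ] E n) (baseEmb hkn (u i)))) with hK
  have hconf : Measurable fun p : (OrthGroup n × E n) × (Fin q → E k) =>
      (Fin.cons p.1.2 (fun i => p.1.2 + (p.1.1 : E n →L[ℝ] E n) (baseEmb hkn (p.2 i))) :
        Fin (q + 1) → E n) := by
    refine measurable_fin_cons.comp ((measurable_snd.comp measurable_fst).prodMk
      (measurable_pi_lambda _ fun i => (measurable_snd.comp measurable_fst).add ?_))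
    exact (measurable_orthGroup_apply n).comp ((measurable_fst.comp measurable_fst).prodMk
      ((baseEmb hkn).continuous.measurable.comp ((measurable_pi_apply i).comp measurable_snd)))
  have hKm : Measurable fun p : OrthGroup n × E n => K p.1 p.2 :=
    Measurable.lintegral_prod_right' (f := fun p : (OrthGroup n × E n) × (Fin q → E k) => w p.2 *
      f (Fin.cons p.1.2 (fun i => p.1.2 + (p.1.1 : E n →L[ℝ] E n) (baseEmb hkn (p.2 i)))))
      ((hwm.comp measurable_snd).mul (hf.comp hconf))
  have hS : Measurable fun x : Fin (q + 1) → E k => ENNReal.ofReal (simplexVolume x ^ (n - k)) :=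
    ((measurable_simplexVolume k q).pow_const _).ennreal_ofReal
  have h1 : ∀ p : OrthGroup n × (basePlane n k)ᗮ,
      ∫⁻ x : Fin (q + 1) → E k, ENNReal.ofReal (simplexVolume x ^ (n - k)) *
        f (placePoints hkn p x) =
      ∫⁻ y : E k, K p.1 ((p.1 : E n →L[ℝ] E n) (baseEmb hkn y + p.2)) := by
    intro p
    have hp : Measurable fun x : Fin (q + 1) → E k =>
        ENNReal.ofReal (simplexVolume x ^ (n - k)) * f (placePoints hkn p x) :=
      hS.mul (hf.comp ((measurable_placePoints hkn).comp measurable_prodMk_left))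
    rw [lintegral_fin_succ_eq_translate hp]
    refine lintegral_congr fun y => lintegral_congr fun u => ?_
    have : placePoints hkn p (Fin.cons y (fun i => y + u i)) =
        Fin.cons ((p.1 : E n →L[ℝ] E n) (baseEmb hkn y + p.2)) (fun i =>
          (p.1 : E n →L[ℝ] E n) (baseEmb hkn y + p.2) +
            (p.1 : E n →L[ℝ] E n) (baseEmb hkn (u i))) := by
      funext i
      refine Fin.cases ?_ (fun i => ?_) i
      · simp [placePoints]
      · simp only [placePoints, Fin.cons_succ, map_add]
        abel
    rw [this, simplexVolume_translate]
  have h2 : ∀ g : OrthGroup n, ∫⁻ z : (basePlane n k)ᗮ, ∫⁻ y : E k,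
      K g ((g : E n →L[ℝ] E n) (baseEmb hkn y + z)) = ∫⁻ y : E n, K g y := by
    intro g
    have hKg : Measurable (K g) := hKm.comp measurable_prodMk_left
    have hmp := (measurePreserving_isometry (orthIsometry g)).comp
      (measurePreserving_baseEmb_add hkn)
    rw [← hmp.lintegral_comp hKg, Measure.volume_eq_prod, lintegral_prod_symm]
    · rfl
    · exact (hKg.comp hmp.measurable).aemeasurable
  have hplace : Measurable fun p : OrthGroup n × (basePlane n k)ᗮ =>
      ∫⁻ x : Fin (q + 1) → E k, ENNReal.ofReal (simplexVolume x ^ (n - k)) *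
        f (placePoints hkn p x) :=
    Measurable.lintegral_prod_right'
      (f := fun p : (OrthGroup n × (basePlane n k)ᗮ) × (Fin (q + 1) → E k) =>
        ENNReal.ofReal (simplexVolume p.2 ^ (n - k)) * f (placePoints hkn p.1 p.2))
      ((hS.comp measurable_snd).mul (hf.comp (measurable_placePoints hkn)))
  have h3 : ∀ y : E n, ∫⁻ v : Fin q → E n, f (Fin.cons y (fun i => y + v i)) =
      ENNReal.ofReal (bpConst n k q) * ∫⁻ g, K g y ∂(orthHaar n) := by
    intro y
    have hfy : Measurable fun v : Fin q → E n => f (Fin.cons y (fun i => y + v i)) := by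
      refine hf.comp (measurable_fin_cons.comp (measurable_const.prodMk ?_))
      fun_prop
    have hq : (0 : ℝ) < q.factorial := by positivity
    have hsplit : ∀ u : Fin q → E k, ENNReal.ofReal (paraVolume u ^ (n - k)) =
        ENNReal.ofReal ((q.factorial : ℝ) ^ (n - k)) * w u := by
      intro u
      rw [hw, ← ENNReal.ofReal_mul (by positivity), ← mul_pow, mul_div_cancel₀ _ hq.ne']
    rw [lintegral_eq_lintegral_orthHaar hqk hkn hfy]
    simp only [hsplit, mul_assoc, lintegral_const_mul' _ _ ENNReal.ofReal_ne_top]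
    rw [← mul_assoc, ← ENNReal.ofReal_mul
      (div_pos (stiefelMass_pos (hqk.trans hkn)) (stiefelMass_pos hqk)).le]
    congr 2
    rw [bpConst]
    ring
  rw [lintegral_prod _ hplace.aemeasurable]
  simp only [h1, h2]
  rw [lintegral_lintegral_swap hKm.aemeasurable, lintegral_fin_succ_eq_translate hf]
  simp only [h3, lintegral_const_mul' _ _ ENNReal.ofReal_ne_top]

/-! ### The affine Grassmannian as a Borel quotient of its parameter space -/

lemma AffGr.foot_mem {n k : ℕ} (τ : AffGr n k) : τ.foot ∈ τ.1 := by
  have : Nonempty τ.1 := τ.2.1.to_subtype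
  exact (EuclideanGeometry.orthogonalProjection τ.1 (0 : E n)).2

lemma AffGr.code_injective (n k : ℕ) : Function.Injective (AffGr.code (n := n) (k := k)) := by
  intro τ τ' h
  have h1 : τ.1.direction = τ'.1.direction :=
    Submodule.starProjection_inj.1 (congrArg Prod.fst h)
  have h2 : τ.foot = τ'.foot := congrArg Prod.snd h
  refine Subtype.ext (AffineSubspace.ext_of_direction_eq h1 ⟨τ.foot, τ.foot_mem, ?_⟩)
  rw [h2]
  exact τ'.foot_mem

lemma AffGr.isEmbedding_code (n k : ℕ) :
    Topology.IsEmbedding (AffGr.code (n := n) (k := k)) :=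
  ⟨⟨rfl⟩, AffGr.code_injective n k⟩

instance (n k : ℕ) : SecondCountableTopology (AffGr n k) :=
  (AffGr.isEmbedding_code n k).secondCountableTopology

instance (n k : ℕ) : T0Space (AffGr n k) :=
  (AffGr.isEmbedding_code n k).t0Space

instance (n : ℕ) : StandardBorelSpace (OrthGroup n) := standardBorel_of_polish

lemma range_baseEmb {n k : ℕ} (hkn : k ≤ n) : Set.range (baseEmb hkn) = basePlane n k := by
  ext x
  constructor
  · rintro ⟨y, rfl⟩
    exact (baseIso hkn y).2
  · intro hx
    exact ⟨(baseIso hkn).symm ⟨x, hx⟩, by simp [baseEmb_apply]⟩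

/-- Every affine `k`-plane is `g (ξ₀ + z)` for some `g ∈ O(n)` and `z ∈ ξ₀ᗮ`. -/
lemma movedPlane_surjective {n k : ℕ} (hkn : k ≤ n) :
    Function.Surjective (movedPlane (n := n) hkn) := by
  intro τ
  obtain ⟨a, ha⟩ := τ.2.1
  let B : E k →ₗᵢ[ℝ] E n := τ.1.direction.subtypeₗᵢ.comp
    ((stdOrthonormalBasis ℝ τ.1.direction).reindex
      (finCongr τ.2.2)).repr.symm.toLinearIsometry
  have hB : ∀ y, B y ∈ τ.1.direction := fun y =>
    ((((stdOrthonormalBasis ℝ τ.1.direction).reindex (finCongr τ.2.2)).repr.symm) y).2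
  obtain ⟨L, hL⟩ := exists_isometry_comp_eq (baseEmb hkn) B
  obtain ⟨g, hg⟩ := exists_orthGroup_eq L
  have hmap : ∀ y ∈ basePlane n k, (g : E n →L[ℝ] E n) y ∈ τ.1.direction := by
    intro y hy
    have hy' : y ∈ Set.range (baseEmb hkn) := by rwa [range_baseEmb]
    obtain ⟨y, rfl⟩ := hy'
    rw [hg, hL]
    exact hB y
  have hdir : (basePlane n k).map (Unitary.linearIsometryEquiv g).toLinearEquiv.toLinearMap =
      τ.1.direction := by
    refine Submodule.eq_of_le_of_finrank_eq ?_ ?_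
    · rintro _ ⟨y, hy, rfl⟩
      exact hmap y hy
    · rw [LinearEquiv.finrank_map_eq, finrank_basePlane hkn, τ.2.2]
  obtain ⟨b, hb⟩ := (Unitary.linearIsometryEquiv g).surjective a
  have hb' : (g : E n →L[ℝ] E n) b = a := hb
  obtain ⟨y, hy, z, hz, hyz⟩ := (basePlane n k).exists_add_mem_mem_orthogonal b
  refine ⟨(g, ⟨z, hz⟩), Subtype.ext ?_⟩
  have hgz : (g : E n →L[ℝ] E n) z ∈ τ.1 := by
    have h1 : (g : E n →L[ℝ] E n) z = -(g : E n →L[ℝ] E n) y +ᵥ a := by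
      rw [← hb', hyz, map_add, vadd_eq_add]
      abel
    rw [h1]
    exact AffineSubspace.vadd_mem_of_mem_direction (neg_mem (hmap y hy)) ha
  change AffineSubspace.mk' _ _ = _
  rw [hdir]
  exact AffineSubspace.mk'_eq hgz

/-- Measurability on the affine Grassmannian may be tested on the parameter space. This rests on
Suslin's theorem that an analytic set with analytic complement is Borel, and needs no measurable
choice of a parameter for each plane. -/
lemma measurable_comp_movedPlane_iff {n k : ℕ} (hkn : k ≤ n) {β : Type*} [MeasurableSpace β]
    {φ : AffGr n k → β} : Measurable (fun p => φ (movedPlane hkn p)) ↔ Measurable φ :=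
  (continuous_movedPlane hkn).measurable.measurable_comp_iff_of_surjective
    (movedPlane_surjective hkn)

/-! ### Integration over a plane in coordinates -/

lemma map_volume_eq_planeMeasure {n k : ℕ} (hkn : k ≤ n) (p : OrthGroup n × (basePlane n k)ᗮ) :
    (volume : Measure (E k)).map (fun x => (p.1 : E n →L[ℝ] E n) (baseEmb hkn x + p.2)) =
      planeMeasure (movedPlane hkn p) := by
  have hiso : Isometry fun x : E k => (p.1 : E n →L[ℝ] E n) (baseEmb hkn x + p.2) :=
    (orthIsometry p.1).isometry.comp
      ((isometry_add_right (p.2 : E n)).comp (baseEmb hkn).isometry)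
  have hrange : Set.range (fun x : E k => (p.1 : E n →L[ℝ] E n) (baseEmb hkn x + p.2)) =
      ((movedPlane hkn p).1 : Set (E n)) := by
    ext y
    change _ ↔ y ∈ AffineSubspace.mk' _ _
    rw [AffineSubspace.mem_mk']
    constructor
    · rintro ⟨x, rfl⟩
      refine ⟨baseEmb hkn x, (baseIso hkn x).2, ?_⟩
      change (p.1 : E n →L[ℝ] E n) (baseEmb hkn x) = _
      simp
    · rintro ⟨v, hv, hvy⟩
      have hv' : v ∈ Set.range (baseEmb hkn) := by rw [range_baseEmb]; exact hv
      obtain ⟨x, rfl⟩ := hv'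
      refine ⟨x, ?_⟩
      have hvy' : (p.1 : E n →L[ℝ] E n) (baseEmb hkn x) = y - (p.1 : E n →L[ℝ] E n) p.2 := hvy
      simp [map_add, hvy']
  rw [planeMeasure, ← hrange, ← hiso.map_euclideanHausdorffMeasure,
    EuclideanSpace.euclideanHausdorffMeasure_eq_volume]

lemma measurePreserving_placePoints {n k : ℕ} (q : ℕ) (hkn : k ≤ n)
    (p : OrthGroup n × (basePlane n k)ᗮ) :
    MeasurePreserving (placePoints (q := q) hkn p) volume
      (Measure.pi fun _ : Fin (q + 1) => planeMeasure (movedPlane hkn p)) := by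
  have hm : Measurable fun x : E k => (p.1 : E n →L[ℝ] E n) (baseEmb hkn x + p.2) := by
    have := (baseEmb hkn).continuous.measurable
    fun_prop
  have hs : SigmaFinite (planeMeasure (movedPlane hkn p)) := by
    have hiso : Isometry fun x : E k => (p.1 : E n →L[ℝ] E n) (baseEmb hkn x + p.2) :=
      (orthIsometry p.1).isometry.comp
        ((isometry_add_right (p.2 : E n)).comp (baseEmb hkn).isometry)
    rw [← map_volume_eq_planeMeasure]
    exact hiso.isClosedEmbedding.measurableEmbedding.sigmaFinite_map
  exact measurePreserving_pi _ _ fun _ => ⟨hm, map_volume_eq_planeMeasure hkn p⟩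

lemma simplexVolume_placePoints {n k q : ℕ} (hkn : k ≤ n) (p : OrthGroup n × (basePlane n k)ᗮ)
    (x : Fin (q + 1) → E k) : simplexVolume (placePoints hkn p x) = simplexVolume x := by
  rw [simplexVolume_eq, simplexVolume_eq]
  have : (fun i : Fin q => placePoints hkn p x i.succ - placePoints hkn p x 0) =
      fun i => ((orthIsometry p.1).comp (baseEmb hkn)) (x i.succ - x 0) := by
    funext i
    simp [placePoints]
  rw [this, paraVolume_isometry]

/-! ### The affine formula for nonnegative functions on the affine Grassmannian -/

lemma lintegral_plane_eq {n k q : ℕ} (hkn : k ≤ n) {f : (Fin (q + 1) → E n) → ℝ≥0∞}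
    (hf : Measurable f) (p : OrthGroup n × (basePlane n k)ᗮ) :
    ∫⁻ x, ENNReal.ofReal (simplexVolume x ^ (n - k)) * f x
        ∂(Measure.pi fun _ : Fin (q + 1) => planeMeasure (movedPlane hkn p)) =
      ∫⁻ x : Fin (q + 1) → E k, ENNReal.ofReal (simplexVolume x ^ (n - k)) *
        f (placePoints hkn p x) := by
  have hm : Measurable fun x : Fin (q + 1) → E n =>
      ENNReal.ofReal (simplexVolume x ^ (n - k)) * f x :=
    ((measurable_simplexVolume n q).pow_const _).ennreal_ofReal.mul hf
  rw [← (measurePreserving_placePoints q hkn p).lintegral_comp hm]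
  simp only [simplexVolume_placePoints]

lemma measurable_lintegral_plane {n k q : ℕ} (hkn : k ≤ n) {f : (Fin (q + 1) → E n) → ℝ≥0∞}
    (hf : Measurable f) :
    Measurable fun τ : AffGr n k => ∫⁻ x, ENNReal.ofReal (simplexVolume x ^ (n - k)) * f x
      ∂(Measure.pi fun _ : Fin (q + 1) => planeMeasure τ) := by
  rw [← measurable_comp_movedPlane_iff hkn]
  simp only [lintegral_plane_eq hkn hf]
  exact Measurable.lintegral_prod_right'
    (f := fun p : (OrthGroup n × (basePlane n k)ᗮ) × (Fin (q + 1) → E k) =>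
      ENNReal.ofReal (simplexVolume p.2 ^ (n - k)) * f (placePoints hkn p.1 p.2))
    ((((measurable_simplexVolume k q).pow_const _).ennreal_ofReal.comp measurable_snd).mul
      (hf.comp (measurable_placePoints hkn)))

/-- The affine Blaschke–Petkantschin formula for nonnegative functions. -/
theorem lintegral_eq_lintegral_affGr {q k n : ℕ} (hqk : q ≤ k) (hkn : k ≤ n)
    {f : (Fin (q + 1) → E n) → ℝ≥0∞} (hf : Measurable f) :
    ∫⁻ x, f x = ENNReal.ofReal (bpConst n k q) *
      ∫⁻ τ : AffGr n k, (∫⁻ x, ENNReal.ofReal (simplexVolume x ^ (n - k)) * f x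
        ∂(Measure.pi fun _ : Fin (q + 1) => planeMeasure τ)) ∂(affGrMeasure hkn) := by
  rw [affGrMeasure, lintegral_map (measurable_lintegral_plane hkn hf)
    (continuous_movedPlane hkn).measurable, lintegral_eq_lintegral_placePoints hqk hkn hf]
  simp only [lintegral_plane_eq hkn hf]

/-! ### Integrable functions -/

lemma bpConst_pos {n k q : ℕ} (hqk : q ≤ k) (hkn : k ≤ n) : 0 < bpConst n k q :=
  div_pos (mul_pos (by positivity) (stiefelMass_pos (hqk.trans hkn))) (stiefelMass_pos hqk)

/-- Functions which agree almost everywhere agree almost everywhere on almost every plane, after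
multiplication with the weight. -/
lemma ae_plane_smul_eq {𝕜 : Type*} [RCLike 𝕜] {n k q : ℕ} (hqk : q ≤ k) (hkn : k ≤ n)
    {F G : (Fin (q + 1) → E n) → 𝕜} (h : F =ᵐ[volume] G) :
    ∀ᵐ τ ∂(affGrMeasure hkn), (fun x => simplexVolume x ^ (n - k) • F x)
      =ᵐ[Measure.pi fun _ : Fin (q + 1) => planeMeasure τ]
        fun x => simplexVolume x ^ (n - k) • G x := by
  -- A measurable null set outside of which the two functions agree.
  set N := toMeasurable volume {x | F x ≠ G x} with hN
  have hNm : MeasurableSet N := measurableSet_toMeasurable _ _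
  have hN0 : volume N = 0 := by
    rw [hN, measure_toMeasurable]
    exact h
  have hm : Measurable (N.indicator (1 : (Fin (q + 1) → E n) → ℝ≥0∞)) :=
    measurable_one.indicator hNm
  have hint := lintegral_eq_lintegral_affGr hqk hkn hm
  rw [lintegral_indicator_one hNm, hN0, eq_comm, mul_eq_zero,
    lintegral_eq_zero_iff (measurable_lintegral_plane hkn hm)] at hint
  have hint' := hint.resolve_left (by simpa using bpConst_pos hqk hkn)
  filter_upwards [hint'] with τ hτ
  have hτm : Measurable fun x : Fin (q + 1) → E n =>
      ENNReal.ofReal (simplexVolume x ^ (n - k)) * N.indicator 1 x :=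
    ((measurable_simplexVolume n q).pow_const _).ennreal_ofReal.mul hm
  rw [Pi.zero_apply, lintegral_eq_zero_iff hτm] at hτ
  filter_upwards [hτ] with x hx
  by_cases hxN : x ∈ N
  · have h0 : simplexVolume x ^ (n - k) = 0 := by
      have : simplexVolume x ^ (n - k) ≤ 0 := by simpa [hxN] using hx
      exact le_antisymm this (pow_nonneg (simplexVolume_nonneg x) _)
    simp [h0]
  · have hFG : F x = G x := by
      by_contra hne
      exact hxN (subset_toMeasurable _ _ hne)
    rw [hFG]

/-- Lebesgue measure on configurations is the image of the weighted measure on the parameter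
space. -/
lemma volume_eq_map_placePoints {q k n : ℕ} (hqk : q ≤ k) (hkn : k ≤ n) :
    (volume : Measure (Fin (q + 1) → E n)) = ENNReal.ofReal (bpConst n k q) •
      ((((orthHaar n).prod (volume : Measure (basePlane n k)ᗮ)).prod
        (volume : Measure (Fin (q + 1) → E k))).withDensity
          (fun p => ENNReal.ofReal (simplexVolume p.2 ^ (n - k)))).map
            (fun p => placePoints hkn p.1 p.2) := by
  have hS : Measurable fun p : (OrthGroup n × (basePlane n k)ᗮ) × (Fin (q + 1) → E k) =>
      ENNReal.ofReal (simplexVolume p.2 ^ (n - k)) :=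
    (((measurable_simplexVolume k q).pow_const _).ennreal_ofReal).comp measurable_snd
  refine Measure.ext_of_lintegral _ fun f hf => ?_
  have hfp : Measurable fun p : (OrthGroup n × (basePlane n k)ᗮ) × (Fin (q + 1) → E k) =>
      f (placePoints hkn p.1 p.2) := hf.comp (measurable_placePoints hkn)
  rw [lintegral_eq_lintegral_placePoints hqk hkn hf, lintegral_smul_measure, smul_eq_mul,
    lintegral_map hf (measurable_placePoints hkn),
    lintegral_withDensity_eq_lintegral_mul _ hS hfp, lintegral_prod _ (hS.mul hfp).aemeasurable]
  rfl

lemma integral_plane_eq {𝕜 : Type*} [RCLike 𝕜] {n k q : ℕ} (hkn : k ≤ n)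
    {F : (Fin (q + 1) → E n) → 𝕜} (hF : Measurable F) (p : OrthGroup n × (basePlane n k)ᗮ) :
    ∫ x, simplexVolume x ^ (n - k) • F x
        ∂(Measure.pi fun _ : Fin (q + 1) => planeMeasure (movedPlane hkn p)) =
      ∫ x : Fin (q + 1) → E k, simplexVolume x ^ (n - k) • F (placePoints hkn p x) := by
  have hp := measurePreserving_placePoints q hkn p
  have hm : Measurable fun x : Fin (q + 1) → E n => simplexVolume x ^ (n - k) • F x :=
    ((measurable_simplexVolume n q).pow_const _).smul hF
  rw [← hp.map_eq, integral_map hp.measurable.aemeasurable hm.aestronglyMeasurable]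
  simp only [simplexVolume_placePoints]

lemma measurable_integral_plane {𝕜 : Type*} [RCLike 𝕜] {n k q : ℕ} (hkn : k ≤ n)
    {F : (Fin (q + 1) → E n) → 𝕜} (hF : Measurable F) :
    Measurable fun τ : AffGr n k => ∫ x, simplexVolume x ^ (n - k) • F x
      ∂(Measure.pi fun _ : Fin (q + 1) => planeMeasure τ) := by
  rw [← measurable_comp_movedPlane_iff hkn]
  simp only [integral_plane_eq hkn hF]
  have hm : Measurable fun p : (OrthGroup n × (basePlane n k)ᗮ) × (Fin (q + 1) → E k) =>
      simplexVolume p.2 ^ (n - k) • F (placePoints hkn p.1 p.2) :=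
    (((measurable_simplexVolume k q).pow_const _).comp measurable_snd).smul
      (hF.comp (measurable_placePoints hkn))
  exact (hm.stronglyMeasurable.integral_prod_right'
    (ν := (volume : Measure (Fin (q + 1) → E k)))).measurable

/-- The affine Blaschke–Petkantschin formula for a Borel measurable integrable function. -/
lemma integral_formula_of_measurable {𝕜 : Type*} [RCLike 𝕜] {n k q : ℕ} (hqk : q ≤ k)
    (hkn : k ≤ n) {F : (Fin (q + 1) → E n) → 𝕜} (hFm : Measurable F) (hF : Integrable F volume) :
    (∀ᵐ τ ∂(affGrMeasure hkn), Integrable (fun x => simplexVolume x ^ (n - k) • F x)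
      (Measure.pi fun _ : Fin (q + 1) => planeMeasure τ)) ∧
    Integrable (fun τ : AffGr n k => ∫ x, simplexVolume x ^ (n - k) • F x
      ∂(Measure.pi fun _ : Fin (q + 1) => planeMeasure τ)) (affGrMeasure hkn) ∧
    ∫ x, F x = bpConst n k q • ∫ τ, (∫ x, simplexVolume x ^ (n - k) • F x
      ∂(Measure.pi fun _ : Fin (q + 1) => planeMeasure τ)) ∂(affGrMeasure hkn) := by
  have hc := bpConst_pos hqk hkn
  have hnorm : ∀ x : Fin (q + 1) → E n, ‖simplexVolume x ^ (n - k) • F x‖ₑ =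
      ENNReal.ofReal (simplexVolume x ^ (n - k)) * ‖F x‖ₑ := fun x => by
    rw [enorm_smul, Real.enorm_of_nonneg (pow_nonneg (simplexVolume_nonneg x) _)]
  have hlint := lintegral_eq_lintegral_affGr hqk hkn hFm.enorm
  have hfin : ∫⁻ τ : AffGr n k, (∫⁻ x, ENNReal.ofReal (simplexVolume x ^ (n - k)) * ‖F x‖ₑ
      ∂(Measure.pi fun _ : Fin (q + 1) => planeMeasure τ)) ∂(affGrMeasure hkn) ≠ ∞ := by
    intro htop
    rw [htop, ENNReal.mul_top (by simpa using hc)] at hlint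
    exact hF.2.ne hlint
  have hmeas := measurable_integral_plane hkn hFm
  have hint : Integrable (fun τ : AffGr n k => ∫ x, simplexVolume x ^ (n - k) • F x
      ∂(Measure.pi fun _ : Fin (q + 1) => planeMeasure τ)) (affGrMeasure hkn) := by
    refine ⟨hmeas.aestronglyMeasurable, lt_of_le_of_lt (lintegral_mono fun τ => ?_) hfin.lt_top⟩
    refine (enorm_integral_le_lintegral_enorm _).trans (le_of_eq ?_)
    simp only [hnorm]
  refine ⟨?_, hint, ?_⟩
  · filter_upwards [ae_lt_top (measurable_lintegral_plane hkn hFm.enorm) hfin] with τ hτ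
    refine ⟨(((measurable_simplexVolume n q).pow_const _).smul hFm).aestronglyMeasurable, ?_⟩
    rw [HasFiniteIntegral]
    simpa only [hnorm] using hτ
  · have hplace := measurable_placePoints (q := q) hkn
    have hS : Measurable fun p : (OrthGroup n × (basePlane n k)ᗮ) × (Fin (q + 1) → E k) =>
        ENNReal.ofReal (simplexVolume p.2 ^ (n - k)) :=
      (((measurable_simplexVolume k q).pow_const _).ennreal_ofReal).comp measurable_snd
    have hvol := volume_eq_map_placePoints (q := q) hqk hkn
    have hto : ∀ x : Fin (q + 1) → E k,
        (ENNReal.ofReal (simplexVolume x ^ (n - k))).toReal = simplexVolume x ^ (n - k) :=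
      fun x => ENNReal.toReal_ofReal (pow_nonneg (simplexVolume_nonneg x) _)
    have hFρ : Integrable (fun p => simplexVolume p.2 ^ (n - k) • F (placePoints hkn p.1 p.2))
        (((orthHaar n).prod (volume : Measure (basePlane n k)ᗮ)).prod
          (volume : Measure (Fin (q + 1) → E k))) := by
      have h1 := hF
      rw [hvol, integrable_smul_measure (by simpa using hc) ENNReal.ofReal_ne_top,
        integrable_map_measure hFm.aestronglyMeasurable hplace.aemeasurable,
        integrable_withDensity_iff_integrable_smul' hS (by simp)] at h1
      simpa only [hto, Function.comp_apply] using h1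
    rw [hvol, integral_smul_measure, ENNReal.toReal_ofReal hc.le,
      integral_map hplace.aemeasurable hFm.aestronglyMeasurable,
      integral_withDensity_eq_integral_toReal_smul hS (by simp)]
    simp only [hto]
    rw [integral_prod _ hFρ, affGrMeasure,
      integral_map (continuous_movedPlane hkn).measurable.aemeasurable hmeas.aestronglyMeasurable]
    simp only [integral_plane_eq hkn hFm]

end BlaschkePetkantschin

theorem theorem3p1 {𝕜 : Type*} [RCLike 𝕜] {n k q : ℕ} (hq : 1 ≤ q) (hqk : q ≤ k) (hkn : k ≤ n)
    (F : (Fin (q + 1) → EuclideanSpace ℝ (Fin n)) → 𝕜)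
    (hF : Integrable F (volume : Measure (Fin (q + 1) → EuclideanSpace ℝ (Fin n)))) :
    (∀ᵐ τ ∂(BlaschkePetkantschin.affGrMeasure hkn),
      Integrable (fun x => (BlaschkePetkantschin.simplexVolume x ^ (n - k)) • F x)
        (Measure.pi fun _ : Fin (q + 1) => BlaschkePetkantschin.planeMeasure τ)) ∧
    Integrable (fun τ : BlaschkePetkantschin.AffGr n k =>
        ∫ x, (BlaschkePetkantschin.simplexVolume x ^ (n - k)) • F x
          ∂(Measure.pi fun _ : Fin (q + 1) => BlaschkePetkantschin.planeMeasure τ))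
      (BlaschkePetkantschin.affGrMeasure hkn) ∧
    ∫ x, F x =
      ((q.factorial : ℝ) ^ (n - k) * BlaschkePetkantschin.stiefelMass n q /
          BlaschkePetkantschin.stiefelMass k q) •
        ∫ τ, (∫ x, (BlaschkePetkantschin.simplexVolume x ^ (n - k)) • F x
            ∂(Measure.pi fun _ : Fin (q + 1) => BlaschkePetkantschin.planeMeasure τ))
          ∂(BlaschkePetkantschin.affGrMeasure hkn) := by
  obtain ⟨G, hGm, hFG⟩ := hF.1.aemeasurable
  have hae := BlaschkePetkantschin.ae_plane_smul_eq hqk hkn hFG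
  have hinner : (fun τ : BlaschkePetkantschin.AffGr n k =>
      ∫ x, (BlaschkePetkantschin.simplexVolume x ^ (n - k)) • F x
        ∂(Measure.pi fun _ : Fin (q + 1) => BlaschkePetkantschin.planeMeasure τ))
      =ᵐ[BlaschkePetkantschin.affGrMeasure hkn] fun τ =>
      ∫ x, (BlaschkePetkantschin.simplexVolume x ^ (n - k)) • G x
        ∂(Measure.pi fun _ : Fin (q + 1) => BlaschkePetkantschin.planeMeasure τ) := by
    filter_upwards [hae] with τ hτ using integral_congr_ae hτ
  obtain ⟨h1, h2, h3⟩ :=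
    BlaschkePetkantschin.integral_formula_of_measurable hqk hkn hGm (hF.congr hFG)
  refine ⟨?_, h2.congr hinner.symm, ?_⟩
  · filter_upwards [hae, h1] with τ hτ hτ1 using hτ1.congr hτ.symm
  · rw [integral_congr_ae hFG, integral_congr_ae hinner, h3]
    rfl
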